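/- Let $p$ be an odd prime and write $\frac{p+1}{8}=\frac mn$ with positive integers $m,n$, $\gcd(m,n)=1$. For $\tau$ in the upper half plane let $\lambda(\tau)=\theta_2(\tau)^4/\theta_3(\tau)^4$, where $\theta_2(\tau)=\sum_{k\in\mathbb Z}e^{\pi i(k+1/2)^2\tau}$ and $\theta_3(\tau)=\sum_{k\in\mathbb Z}e^{\pi i k^2\tau}$, and put $$X=\bigl(\lambda(\tau)\lambda(p\tau)\bigr)^{n/8},\qquad Y=\bigl((1-\lambda(\tau))(1-\lambda(p\tau))\bigr)^{n/8},$$ the branches being holomorphic on the upper half plane and positive on the imaginary axis. Let $A_p=(a_{i,h})_{0\le i,h\le m}$ be Russell's coefficient matrix, i.e. an integer matrix with $a_{0,0}=1$, $a_{i,h}=0$ for $i+h>m$, and $\sum_{i,h=0}^m a_{i,h}X^iY^h=0$ on the upper half plane. Let $$\alpha_p(k)=s_k(1)-3s_k(2)+2s_k(4)+s_k(p)-3s_k(2p)+2s_k(4p),\qquad s_k(d)=\frac{\sigma_1(k/d)}{k/d}\ \text{ if } d\mid k,\quad s_k(d)=0\ \text{ otherwise},$$ where $\sigma_1$ is the sum-of-divisors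 function, and for $r\ge 0$ let $$P_r(m)=\frac{(-1)^m}{(m+r)!}\sum_{h=0}^m(-1)^h\binom mh h^{m+r}$$ (so that $P_0(m)=1$, $P_1(m)=\frac m2$, $P_2(m)=\frac{m(3m+1)}{24}$). Then $$\sum_{h=0}^m a_{1,h}=-n^m2^{m-n},\qquad \sum_{h=0}^m(1+2h)\,a_{1,h}=-n^m2^{m+1-n}P_1(m),$$ $$\sum_{h=0}^m(1+2h)^2a_{1,h}=-n^m2^{m+3-n}P_2(m)-n^{m-1}2^{m+1-n}\alpha_p(2)-n^{m-2}2^{m+1-n}\,m\,\alpha_p(3).$$ -/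

import Mathlib

noncomputable section

namespace RussellModular

/-- The theta constant `θ₂(τ) = ∑_{k ∈ ℤ} exp(π i (k + 1/2)² τ)`. -/
def theta2 (τ : ℂ) : ℂ :=
  ∑' k : ℤ, Complex.exp (Real.pi * Complex.I * ((k : ℂ) + 1 / 2) ^ 2 * τ)

/-- The modular function `λ(τ) = θ₂(τ)⁴ / θ₃(τ)⁴`; the theta constant
`θ₃(τ) = ∑_{k ∈ ℤ} exp(π i k² τ)` is Mathlib's `jacobiTheta`. -/
def modularLambda (τ : ℂ) : ℂ := theta2 τ ^ 4 / jacobiTheta τ ^ 4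

/-- `g` is the branch of the fractional power `f ^ (n / 8)` on the upper half plane that is
holomorphic there and positive on the imaginary axis. -/
structure IsEighthPower (f : ℂ → ℂ) (n : ℕ) (g : ℂ → ℂ) : Prop where
  holo : DifferentiableOn ℂ g UpperHalfPlane.upperHalfPlaneSet
  pow_eq : ∀ τ ∈ UpperHalfPlane.upperHalfPlaneSet, g τ ^ 8 = f τ ^ n
  pos : ∀ t : ℝ, 0 < t → ∃ r : ℝ, 0 < r ∧ g (Complex.I * t) = r

/-- `A` is Russell's coefficient matrix for the odd prime `p`, where `(p + 1) / 8 = m / n` in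
lowest terms: a triangular integer matrix `(a_{i,h})`, `0 ≤ i, h ≤ m`, normalised by
`a_{0,0} = 1`, for which `∑ a_{i,h} X^i Y^h` vanishes on the upper half plane, with
`X = (λ(τ) λ(pτ)) ^ (n / 8)` and `Y = ((1 - λ(τ)) (1 - λ(pτ))) ^ (n / 8)`. -/
structure IsRussellMatrix (p m n : ℕ) (A : Matrix (Fin (m + 1)) (Fin (m + 1)) ℤ) : Prop where
  corner : A 0 0 = 1
  triangular : ∀ i h : Fin (m + 1), m < (i : ℕ) + (h : ℕ) → A i h = 0
  vanishes : ∃ X Y : ℂ → ℂ,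
    IsEighthPower (fun τ => modularLambda τ * modularLambda (p * τ)) n X ∧
    IsEighthPower (fun τ => (1 - modularLambda τ) * (1 - modularLambda (p * τ))) n Y ∧
    ∀ τ ∈ UpperHalfPlane.upperHalfPlaneSet,
      ∑ i : Fin (m + 1), ∑ h : Fin (m + 1), (A i h : ℂ) * X τ ^ (i : ℕ) * Y τ ^ (h : ℕ) = 0

/-- `σ₁(k / d) / (k / d)`, read as `0` when `d` does not divide `k`. -/
def sigmaQuot (k d : ℕ) : ℚ :=
  if d ∣ k then (ArithmeticFunction.sigma 1 (k / d) : ℚ) / ((k / d : ℕ) : ℚ) else 0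

/-- The function `α_p(k)`. -/
def alpha (p k : ℕ) : ℚ :=
  sigmaQuot k 1 - 3 * sigmaQuot k 2 + 2 * sigmaQuot k 4
    + sigmaQuot k p - 3 * sigmaQuot k (2 * p) + 2 * sigmaQuot k (4 * p)

/-- The value `P_r(m)`, determined with `N = m + r` by
`∑_{h=0}^m h^N (-1)^(h-1) (m choose h) = (-1)^(m-1) P_{N-m}(m) N!`. -/
def stirlingP (r m : ℕ) : ℚ :=
  (-1) ^ m * (∑ h ∈ Finset.range (m + 1), (-1) ^ h * (m.choose h : ℚ) * (h : ℚ) ^ (m + r))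
    / ((m + r).factorial : ℚ)

end RussellModular

end

/-!
Along the imaginary axis everything is a real function of `q = e ^ (π i τ) → 0⁺`, and the theorem
follows from the first terms of the asymptotic expansions in `q` of the quantities involved.

With `S = θ₂ / (2 q ^ (1/4)) = 1 + q ^ 2 + O(q ^ 4)` and `T = θ₃ = 1 + 2 q + O(q ^ 4)` one has
`λ = 16 q (S / T) ^ 4`. Since `n (p + 1) = 8 m`, this gives `X = 2 ^ n q ^ m u` with
`u = 1 - n q + (3 n + n ^ 2) / 2 q ^ 2 + O(q ^ 3)` (`exists_hasExpansion_X`), and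
`1 - Y = 2 n q w` with `w = 1 - n q + (α_p(3) + 2 n ^ 2 / 3) q ^ 2 + O(q ^ 3)` (from
`hasExpansion_Y`). The positivity of `X` and `Y` on the imaginary axis selects the eighth roots
(`HasExpansion.of_pow`).

Write the relation as `f₀(Y) + X f₁(Y) + X ^ 2 f₂(Y) + ⋯ = 0`, where `f_i` is the polynomial of the
`i`-th row of the matrix. The polynomial `f₀` has degree at most `m` and constant term `1`, and
`f₀(Y) = O(q ^ m)` while `1 - Y` vanishes to the first order only; hence `f₀(Y) = (1 - Y) ^ m`
(`eq_one_sub_X_pow_of_isBigO`). Division by `q ^ m` leaves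
`(2 n) ^ m w ^ m + 2 ^ n u f₁(Y) = O(q ^ m)`, whose first three coefficients determine
`∑ a_{1,h}`, `∑ h a_{1,h}` and `∑ h ^ 2 a_{1,h}` (`row_one_moments`). The error term is harmless for
`m ≥ 3` and absent for `m = 1`; `m = 2` does not occur, as it would make `p = 15`.

On the arithmetic side, `P_r(m)` is the coefficient of `X ^ r` in `((e ^ X - 1) / X) ^ m`
(`stirlingP_eq_coeff`), and `α_p(2) = -3 / 2`, `α_p(3) = 4 / 3`, increased by `1` if `p = 3`.
-/

namespace RussellModular
open Filter Topology Asymptotics PowerSeries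

/-! ### One-sided asymptotic expansions -/

/-- `f q = φ₀ + φ₁ q + ⋯ + φ_{N-1} q ^ (N - 1) + O(q ^ N)` as `q → 0⁺`, the coefficients being
those of the power series `φ`; its coefficients from degree `N` on are irrelevant. -/
def HasExpansion (N : ℕ) (f : ℝ → ℝ) (φ : ℝ⟦X⟧) : Prop :=
  (fun q => f q - (trunc N φ).eval q) =O[𝓝[>] 0] (fun q => q ^ N)

theorem isBigO_eval_one (P : Polynomial ℝ) :
    (fun q => P.eval q) =O[𝓝[>] (0 : ℝ)] (fun _ => (1 : ℝ)) :=
  (P.continuous.continuousAt.tendsto.mono_left nhdsWithin_le_nhds).isBigO_one ℝ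

theorem isBigO_eval_of_X_pow_dvd {N : ℕ} {P : Polynomial ℝ} (h : Polynomial.X ^ N ∣ P) :
    (fun q => P.eval q) =O[𝓝[>] (0 : ℝ)] (fun q => q ^ N) := by
  obtain ⟨Q, rfl⟩ := h
  simpa using (isBigO_refl (fun q : ℝ => q ^ N) (𝓝[>] 0)).mul (isBigO_eval_one Q)

theorem isBigO_pow_of_le {M N : ℕ} (h : M ≤ N) :
    (fun q : ℝ => q ^ N) =O[𝓝[>] 0] (fun q => q ^ M) := by
  obtain ⟨k, rfl⟩ := Nat.exists_eq_add_of_le h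
  simpa using isBigO_eval_of_X_pow_dvd (N := M) (P := Polynomial.X ^ (M + k)) ⟨_, pow_add _ _ _⟩

/-- Any polynomial whose coefficients agree with those of `φ` below degree `N` may replace the
truncation in the definition of an expansion. -/
theorem hasExpansion_iff {N : ℕ} {f : ℝ → ℝ} {φ : ℝ⟦X⟧} (P : Polynomial ℝ)
    (h : ∀ i < N, P.coeff i = coeff i φ) :
    HasExpansion N f φ ↔ (fun q => f q - P.eval q) =O[𝓝[>] 0] (fun q => q ^ N) := by
  have hd : (fun q => (P - trunc N φ).eval q) =O[𝓝[>] (0 : ℝ)] (fun q => q ^ N) := by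
    apply isBigO_eval_of_X_pow_dvd
    rw [Polynomial.X_pow_dvd_iff]
    intro d hd
    simp [coeff_trunc, hd, h d hd]
  constructor
  · intro hf
    refine (hf.sub hd).congr_left fun q => ?_
    simp
  · intro hf
    refine (hf.add hd).congr_left fun q => ?_
    simp

namespace HasExpansion

variable {M N : ℕ} {f g : ℝ → ℝ} {φ ψ : ℝ⟦X⟧}

theorem congr_coeff (hf : HasExpansion N f φ) (h : ∀ i < N, coeff i φ = coeff i ψ) :
    HasExpansion N f ψ :=
  (hasExpansion_iff (trunc N φ) fun i hi => by simp [coeff_trunc, hi, h i hi]).2 hf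

theorem congr_fun (hf : HasExpansion N f φ) (h : f =ᶠ[𝓝[>] 0] g) : HasExpansion N g φ :=
  hf.congr' (h.mono fun q hq => by simp [hq]) (EventuallyEq.refl _ _)

theorem mono (hf : HasExpansion N f φ) (h : M ≤ N) : HasExpansion M f φ :=
  (hasExpansion_iff (trunc N φ) fun i hi => by simp [coeff_trunc, hi.trans_le h]).2
    (hf.trans (isBigO_pow_of_le h))

theorem polynomial (N : ℕ) (P : Polynomial ℝ) : HasExpansion N (fun q => P.eval q) (P : ℝ⟦X⟧) :=
  (hasExpansion_iff P fun i _ => by simp).2 (by simpa using isBigO_zero _ _)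

theorem const (N : ℕ) (a : ℝ) : HasExpansion N (fun _ => a) (C a) := by
  simpa using polynomial N (Polynomial.C a)

theorem add (hf : HasExpansion N f φ) (hg : HasExpansion N g ψ) :
    HasExpansion N (fun q => f q + g q) (φ + ψ) :=
  (IsBigO.add hf hg).congr_left fun q => by simp; ring

theorem sub (hf : HasExpansion N f φ) (hg : HasExpansion N g ψ) :
    HasExpansion N (fun q => f q - g q) (φ - ψ) :=
  (IsBigO.sub hf hg).congr_left fun q => by simp; ring

theorem sum {ι : Type*} {s : Finset ι} {F : ι → ℝ → ℝ} {Φ : ι → ℝ⟦X⟧}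
    (h : ∀ i ∈ s, HasExpansion N (F i) (Φ i)) :
    HasExpansion N (fun q => ∑ i ∈ s, F i q) (∑ i ∈ s, Φ i) := by
  classical
  induction s using Finset.induction_on with
  | empty => simpa using const N 0
  | insert a s ha ih =>
    simp only [Finset.sum_insert ha]
    exact (h a (by simp)).add (ih fun i hi => h i (by simp [hi]))

theorem isBigO_one (hf : HasExpansion N f φ) : f =O[𝓝[>] 0] (fun _ => (1 : ℝ)) := by
  have h1 : (fun q => f q - (trunc N φ).eval q) =O[𝓝[>] 0] (fun _ => (1 : ℝ)) := by
    simpa using IsBigO.trans hf (isBigO_pow_of_le (Nat.zero_le N))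
  exact (h1.add (isBigO_eval_one (trunc N φ))).congr_left fun q => by ring

theorem mul (hf : HasExpansion N f φ) (hg : HasExpansion N g ψ) :
    HasExpansion N (fun q => f q * g q) (φ * ψ) := by
  refine (hasExpansion_iff (trunc N φ * trunc N ψ) fun i hi => ?_).2 ?_
  · rw [Polynomial.coeff_mul, coeff_mul]
    refine Finset.sum_congr rfl fun x hx => ?_
    have := Finset.HasAntidiagonal.mem_antidiagonal.1 hx
    rw [coeff_trunc, coeff_trunc, if_pos (by omega), if_pos (by omega)]
  · have h1 := IsBigO.mul hf hg.isBigO_one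
    have h2 := (isBigO_eval_one (trunc N φ)).mul hg
    simp only [mul_one] at h1
    simp only [one_mul] at h2
    have h1 := h1.add h2
    exact h1.congr_left fun q => by simp; ring

theorem pow (hf : HasExpansion N f φ) (k : ℕ) : HasExpansion N (fun q => f q ^ k) (φ ^ k) := by
  induction k with
  | zero => simpa using const N 1
  | succ k ih => simpa only [pow_succ] using ih.mul hf

theorem const_mul (a : ℝ) (hf : HasExpansion N f φ) :
    HasExpansion N (fun q => a * f q) (C a * φ) :=
  (const N a).mul hf

theorem tendsto (hf : HasExpansion N f φ) (hN : 0 < N) :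
    Tendsto f (𝓝[>] 0) (𝓝 (coeff 0 φ)) := by
  have h1 : Tendsto (fun q => f q - (trunc N φ).eval q) (𝓝[>] 0) (𝓝 0) := by
    refine IsBigO.trans_tendsto hf ?_
    have : Tendsto (fun q : ℝ => q ^ N) (𝓝 0) (𝓝 (0 ^ N)) := (continuous_pow N).tendsto 0
    rw [zero_pow hN.ne'] at this
    exact this.mono_left nhdsWithin_le_nhds
  have h2 : Tendsto (fun q => (trunc N φ).eval q) (𝓝[>] 0) (𝓝 ((trunc N φ).eval 0)) :=
    ((trunc N φ).continuous.tendsto 0).mono_left nhdsWithin_le_nhds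
  rw [← Polynomial.coeff_zero_eq_eval_zero, coeff_trunc, if_pos hN] at h2
  simpa using h1.add h2

/-- Multiplication by `q ^ k` improves the order of the error term by `k`. -/
theorem pow_mul (k : ℕ) (hf : HasExpansion N f φ) :
    HasExpansion (k + N) (fun q => q ^ k * f q) (X ^ k * φ) := by
  refine (hasExpansion_iff (Polynomial.X ^ k * trunc N φ) fun i hi => ?_).2 ?_
  · rw [Polynomial.coeff_X_pow_mul', coeff_X_pow_mul']
    split_ifs
    · rw [coeff_trunc, if_pos (by omega)]
    · rfl
  · refine ((isBigO_refl (fun q : ℝ => q ^ k) (𝓝[>] 0)).mul hf).congr (fun q => ?_) fun q => ?_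
    · simp; ring
    · ring

/-- Division by `q ^ k`, at the cost of `k` orders in the error term. -/
theorem of_pow_mul (k : ℕ) (hf : HasExpansion (k + N) (fun q => q ^ k * f q) (X ^ k * φ)) :
    HasExpansion N f φ := by
  rw [hasExpansion_iff (Polynomial.X ^ k * trunc N φ) fun i hi => ?_] at hf
  · refine ((isBigO_refl (fun q : ℝ => (q ^ k)⁻¹) (𝓝[>] 0)).mul hf).congr' ?_ ?_
    all_goals
      filter_upwards [self_mem_nhdsWithin] with q hq
      have hq : (0 : ℝ) < q := hq
      simp only [Polynomial.eval_mul, Polynomial.eval_pow, Polynomial.eval_X, pow_add]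
      field_simp
  · rw [Polynomial.coeff_X_pow_mul', coeff_X_pow_mul']
    split_ifs
    · rw [coeff_trunc, if_pos (by omega)]
    · rfl

theorem coeff_eq (hf : HasExpansion N f φ) (hg : HasExpansion N f ψ) {i : ℕ} (hi : i < N) :
    coeff i φ = coeff i ψ := by
  induction N generalizing f φ ψ i with
  | zero => omega
  | succ N ih =>
    have h0 : coeff 0 φ = coeff 0 ψ :=
      tendsto_nhds_unique (hf.tendsto N.succ_pos) (hg.tendsto N.succ_pos)
    rcases i with _ | i
    · exact h0
    · have key : ∀ {χ : ℝ⟦X⟧}, HasExpansion (N + 1) f χ →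
          HasExpansion N (fun q => (f q - coeff 0 χ) / q)
            (PowerSeries.mk fun j => coeff (j + 1) χ) := by
        intro χ h
        refine of_pow_mul 1 ?_
        rw [add_comm 1 N]
        refine ((h.sub (const (N + 1) (coeff 0 χ))).congr_fun ?_).congr_coeff fun j _ => ?_
        · filter_upwards [self_mem_nhdsWithin] with q hq
          have hq : (0 : ℝ) < q := hq
          field_simp
        · rcases j with _ | j
          · simp
          · simp
      have h1 := key hf
      have h2 := key hg
      rw [← h0] at h2
      simpa using ih h1 h2 (show i < N by omega)

theorem inv (hf : HasExpansion N f φ) (hN : 0 < N) (h : ∀ i < N, coeff i (φ * ψ) = coeff i 1) :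
    HasExpansion N (fun q => (f q)⁻¹) ψ := by
  have h0 : coeff 0 φ ≠ 0 := by
    intro h0
    have := h 0 hN
    simp only [coeff_zero_eq_constantCoeff, map_mul] at this h0
    simp [h0] at this
  have ht := hf.tendsto hN
  have hb : (fun q => (f q)⁻¹) =O[𝓝[>] 0] (fun _ => (1 : ℝ)) := (ht.inv₀ h0).isBigO_one ℝ
  have hQ : HasExpansion N (fun q => (trunc N ψ).eval q) ψ :=
    (polynomial N (trunc N ψ)).congr_coeff fun i hi => by simp [coeff_trunc, hi]
  have h1 : HasExpansion N (fun q => f q * (trunc N ψ).eval q) 1 := (hf.mul hQ).congr_coeff h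
  rw [hasExpansion_iff 1 (by simp [Polynomial.coeff_one, coeff_one])] at h1
  have h2 := hb.mul h1.neg_left
  simp only [one_mul] at h2
  refine h2.congr' ?_ (EventuallyEq.refl _ _)
  filter_upwards [ht.eventually_ne h0] with q hq
  simp only [Polynomial.eval_one]
  field_simp
  ring

/-- Expansions may be extracted from those of a power, the branch being fixed by positivity. -/
theorem of_pow {k : ℕ} (hk : k ≠ 0) (hN : 0 < N) (hf : HasExpansion N (fun q => f q ^ k) ψ)
    (hpos : ∀ᶠ q in 𝓝[>] 0, 0 ≤ f q) (h0 : coeff 0 φ = 1)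
    (h : ∀ i < N, coeff i (φ ^ k) = coeff i ψ) : HasExpansion N f φ := by
  set P := trunc N φ with hP
  have hQ : HasExpansion N (fun q => P.eval q) φ :=
    (polynomial N P).congr_coeff fun i hi => by simp [hP, coeff_trunc, hi]
  have h1 := hf.sub ((hQ.pow k).congr_coeff h)
  rw [sub_self, hasExpansion_iff 0 (by simp)] at h1
  have ht := hQ.tendsto hN
  rw [h0] at ht
  refine IsBigO.trans (IsBigO.of_bound ((2 : ℝ) ^ (k - 1)) ?_) h1
  filter_upwards [hpos, ht.eventually_const_lt (show (1 / 2 : ℝ) < 1 by norm_num)] with q hq hPq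
  have hs : (1 / 2 : ℝ) ^ (k - 1) ≤ ∑ i ∈ Finset.range k, f q ^ i * P.eval q ^ (k - 1 - i) := by
    refine le_trans ?_ (Finset.single_le_sum (f := fun i => f q ^ i * P.eval q ^ (k - 1 - i))
      (fun i _ => by positivity) (Finset.mem_range.2 (Nat.pos_of_ne_zero hk)))
    simp only [pow_zero, one_mul, Nat.sub_zero]
    gcongr
  have hg := geom_sum₂_mul (f q) (P.eval q) k
  simp only [Polynomial.eval_zero, sub_zero, Real.norm_eq_abs]
  rw [← hg, abs_mul]
  have h3 : (1 / 2 : ℝ) ^ (k - 1) * |f q - P.eval q| ≤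
      |∑ i ∈ Finset.range k, f q ^ i * P.eval q ^ (k - 1 - i)| * |f q - P.eval q| := by
    gcongr
    exact hs.trans (le_abs_self _)
  calc |f q - P.eval q| = 2 ^ (k - 1) * ((1 / 2 : ℝ) ^ (k - 1) * |f q - P.eval q|) := by
        rw [← mul_assoc, ← mul_pow]; norm_num
    _ ≤ _ := by gcongr

/-- The substitution of `q ^ p` for `q`, to the order `q ^ p`: only the constant term survives. -/
theorem comp_pow (hf : HasExpansion 1 f φ) {p : ℕ} (hp : p ≠ 0) :
    HasExpansion p (fun q => f (q ^ p)) (C (coeff 0 φ)) := by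
  rw [hasExpansion_iff (Polynomial.C (coeff 0 φ)) fun i hi => ?_] at hf
  · rw [hasExpansion_iff (Polynomial.C (coeff 0 φ))
      fun i _ => by simp [Polynomial.coeff_C, coeff_C]]
    have ht : Tendsto (fun q : ℝ => q ^ p) (𝓝[>] 0) (𝓝[>] 0) := by
      refine tendsto_nhdsWithin_iff.2 ⟨?_, ?_⟩
      · have : Tendsto (fun q : ℝ => q ^ p) (𝓝 0) (𝓝 (0 ^ p)) := (continuous_pow p).tendsto 0
        rw [zero_pow hp] at this
        exact this.mono_left nhdsWithin_le_nhds
      · filter_upwards [self_mem_nhdsWithin] with q hq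
        exact pow_pos (Set.mem_Ioi.1 hq) p
    simpa [Function.comp_def] using hf.comp_tendsto ht
  · obtain rfl : i = 0 := by omega
    simp

end HasExpansion

/-! ### Low coefficients of products and powers of power series -/

section LowCoeff

variable {K : Type*} [Field K]

theorem coeff_zero_mul (φ ψ : K⟦X⟧) : coeff 0 (φ * ψ) = coeff 0 φ * coeff 0 ψ := by simp

theorem coeff_one_mul' (φ ψ : K⟦X⟧) :
    coeff 1 (φ * ψ) = coeff 0 φ * coeff 1 ψ + coeff 1 φ * coeff 0 ψ := by
  rw [coeff_mul, Finset.Nat.sum_antidiagonal_eq_sum_range_succ (fun i j => coeff i φ * coeff j ψ)]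
  simp [Finset.sum_range_succ]

theorem coeff_two_mul (φ ψ : K⟦X⟧) :
    coeff 2 (φ * ψ) =
      coeff 0 φ * coeff 2 ψ + coeff 1 φ * coeff 1 ψ + coeff 2 φ * coeff 0 ψ := by
  rw [coeff_mul, Finset.Nat.sum_antidiagonal_eq_sum_range_succ (fun i j => coeff i φ * coeff j ψ)]
  simp [Finset.sum_range_succ]

theorem coeff_three_mul (φ ψ : K⟦X⟧) :
    coeff 3 (φ * ψ) = coeff 0 φ * coeff 3 ψ + coeff 1 φ * coeff 2 ψ + coeff 2 φ * coeff 1 ψ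
      + coeff 3 φ * coeff 0 ψ := by
  rw [coeff_mul, Finset.Nat.sum_antidiagonal_eq_sum_range_succ (fun i j => coeff i φ * coeff j ψ)]
  simp [Finset.sum_range_succ]

theorem coeff_zero_pow_of_eq_one {φ : K⟦X⟧} (h : coeff 0 φ = 1) (k : ℕ) :
    coeff 0 (φ ^ k) = 1 := by
  rw [coeff_zero_eq_constantCoeff] at *
  simp [h]

theorem coeff_one_pow_of_eq_one {φ : K⟦X⟧} (h : coeff 0 φ = 1) (k : ℕ) :
    coeff 1 (φ ^ k) = k * coeff 1 φ := by
  induction k with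
  | zero => simp [coeff_one]
  | succ k ih =>
    rw [pow_succ, coeff_one_mul', ih, coeff_zero_pow_of_eq_one h, h]
    push_cast; ring

theorem coeff_two_pow_of_eq_one [CharZero K] {φ : K⟦X⟧} (h : coeff 0 φ = 1) (k : ℕ) :
    coeff 2 (φ ^ k) = k * coeff 2 φ + k * (k - 1) / 2 * coeff 1 φ ^ 2 := by
  induction k with
  | zero => simp [coeff_one]
  | succ k ih =>
    rw [pow_succ, coeff_two_mul, ih, coeff_one_pow_of_eq_one h, coeff_zero_pow_of_eq_one h, h]
    push_cast; ring

theorem coeff_three_pow_of_eq_one [CharZero K] {φ : K⟦X⟧} (h : coeff 0 φ = 1) (k : ℕ) :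
    coeff 3 (φ ^ k) = k * coeff 3 φ + k * (k - 1) * coeff 1 φ * coeff 2 φ
      + k * (k - 1) * (k - 2) / 6 * coeff 1 φ ^ 3 := by
  induction k with
  | zero => simp [coeff_one]
  | succ k ih =>
    rw [pow_succ, coeff_three_mul, ih, coeff_two_pow_of_eq_one h, coeff_one_pow_of_eq_one h,
      coeff_zero_pow_of_eq_one h, h]
    push_cast; ring

/-- The cubic polynomial `a + b X + c X² + d X³`, as a power series. -/
def cubicSeries (a b c d : K) : K⟦X⟧ :=
  PowerSeries.mk fun i => match i with
    | 0 => a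
    | 1 => b
    | 2 => c
    | 3 => d
    | _ => 0

variable (a b c d : K)

@[simp] theorem coeff_zero_cubicSeries : coeff 0 (cubicSeries a b c d) = a := coeff_mk _ _
@[simp] theorem constantCoeff_cubicSeries : constantCoeff (cubicSeries a b c d) = a := by
  rw [← coeff_zero_eq_constantCoeff_apply, coeff_zero_cubicSeries]
@[simp] theorem coeff_one_cubicSeries : coeff 1 (cubicSeries a b c d) = b := coeff_mk _ _
@[simp] theorem coeff_two_cubicSeries : coeff 2 (cubicSeries a b c d) = c := coeff_mk _ _
@[simp] theorem coeff_three_cubicSeries : coeff 3 (cubicSeries a b c d) = d := coeff_mk _ _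

end LowCoeff

/-! ### The numbers `P₁(m)`, `P₂(m)` and `α_p(2)`, `α_p(3)` -/

/-- The generating function of the `P_r(m)` is `((e ^ X - 1) / X) ^ m`. -/
theorem stirlingP_eq_coeff (r m : ℕ) :
    stirlingP r m = coeff r ((PowerSeries.mk fun i => (1 / ((i + 1).factorial : ℚ))) ^ m) := by
  have hX : exp ℚ - 1 = X * PowerSeries.mk fun i => (1 / ((i + 1).factorial : ℚ)) := by
    ext i
    rcases i with _ | i
    · simp
    · simp [coeff_succ_X_mul, coeff_exp, coeff_one]
  have h1 : coeff (m + r) ((exp ℚ - 1) ^ m) =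
      coeff r ((PowerSeries.mk fun i => (1 / ((i + 1).factorial : ℚ))) ^ m) := by
    rw [hX, mul_pow, add_comm, coeff_X_pow_mul]
  rw [← h1, sub_eq_add_neg, add_pow, map_sum, stirlingP, Finset.mul_sum, Finset.sum_div]
  refine Finset.sum_congr rfl fun h hh => ?_
  have hm : h ≤ m := Nat.lt_succ_iff.1 (Finset.mem_range.1 hh)
  have hsign : (-1 : ℚ) ^ m = (-1) ^ (m - h) * (-1) ^ h := by
    rw [← pow_add, Nat.sub_add_cancel hm]
  have hsq : (-1 : ℚ) ^ h * (-1) ^ h = 1 := by rw [← mul_pow]; simp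
  have h2 : (exp ℚ) ^ h * (-1) ^ (m - h) * (m.choose h : ℚ⟦X⟧) =
      C ((-1) ^ (m - h) * (m.choose h : ℚ)) * rescale (h : ℚ) (exp ℚ) := by
    rw [exp_pow_eq_rescale_exp]
    simp
    ring
  rw [h2, coeff_C_mul, coeff_rescale, coeff_exp, hsign]
  simp only [Algebra.algebraMap_self, RingHom.id_apply]
  linear_combination ((-1 : ℚ) ^ (m - h) * (m.choose h) * h ^ (m + r) / (m + r).factorial) * hsq

theorem stirlingP_one (m : ℕ) : stirlingP 1 m = m / 2 := by
  rw [stirlingP_eq_coeff, coeff_one_pow_of_eq_one (by simp)]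
  simp
  ring

theorem stirlingP_two (m : ℕ) : stirlingP 2 m = m * (3 * m + 1) / 24 := by
  rw [stirlingP_eq_coeff, coeff_two_pow_of_eq_one (by simp)]
  simp [Nat.factorial]
  ring

theorem alpha_two {p : ℕ} (hp : 3 ≤ p) : alpha p 2 = -3 / 2 := by
  have h1 : ¬ p ∣ 2 := fun h => by have := Nat.le_of_dvd (by norm_num) h; omega
  have h2 : ¬ 2 * p ∣ 2 := fun h => by have := Nat.le_of_dvd (by norm_num) h; omega
  have h3 : ¬ 4 * p ∣ 2 := fun h => by have := Nat.le_of_dvd (by norm_num) h; omega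
  have hs : ArithmeticFunction.sigma 1 2 = 3 := by decide
  simp [alpha, sigmaQuot, h1, h2, h3, hs]
  norm_num

theorem alpha_three {p : ℕ} (hp : 3 ≤ p) : alpha p 3 = 4 / 3 + if p = 3 then 1 else 0 := by
  have h2 : ¬ 2 * p ∣ 3 := fun h => by have := Nat.le_of_dvd (by norm_num) h; omega
  have h3 : ¬ 4 * p ∣ 3 := fun h => by have := Nat.le_of_dvd (by norm_num) h; omega
  have h1 : p ∣ 3 ↔ p = 3 :=
    ⟨fun h => le_antisymm (Nat.le_of_dvd (by norm_num) h) hp, fun h => h ▸ dvd_rfl⟩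
  have hs : ArithmeticFunction.sigma 1 3 = 4 := by decide
  split_ifs with h
  · subst h
    simp [alpha, sigmaQuot, hs]
  · simp [alpha, sigmaQuot, h1, h, h2, h3, hs]

/-! ### Theta constants on the imaginary axis -/

/-- A theta series `∑ q ^ e(k)` is expanded by its finitely many terms of low exponent. -/
theorem isBigO_tsum_pow_sub_sum {e : ℤ → ℕ} (he : ∀ k, k.natAbs ≤ e k + 1) (N : ℕ)
    (F : Finset ℤ) (hF : ∀ k ∉ F, N ≤ e k) :
    (fun q : ℝ => ∑' k, q ^ e k - ∑ k ∈ F, q ^ e k) =O[𝓝[>] 0] (fun q => q ^ N) := by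
  have hgeom : Summable fun k : ℤ => (1 / 2 : ℝ) ^ k.natAbs := by
    refine Summable.of_nat_of_neg ?_ ?_ <;> simpa using summable_geometric_two
  have hsum : Summable fun k : ℤ => (1 / 2 : ℝ) ^ e k := by
    refine Summable.of_nonneg_of_le (fun k => by positivity) (fun k => ?_) (hgeom.mul_left 2)
    have := pow_le_pow_of_le_one (by norm_num : (0 : ℝ) ≤ 1 / 2) (by norm_num) (he k)
    rw [pow_succ] at this
    linarith
  have hq : ∀ᶠ q : ℝ in 𝓝[>] 0, 0 < q ∧ q < 1 / 2 := by
    filter_upwards [Ioo_mem_nhdsGT (show (0 : ℝ) < 1 / 2 by norm_num)] with q hq using hq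
  refine IsBigO.of_bound (2 ^ N * ∑' k, (1 / 2 : ℝ) ^ e k) ?_
  filter_upwards [hq] with q ⟨hq0, hq1⟩
  have hsq : Summable fun k : ℤ => q ^ e k :=
    hsum.of_nonneg_of_le (fun k => by positivity) fun k => by gcongr
  rw [← hsq.sum_add_tsum_compl (s := F), add_sub_cancel_left, Real.norm_of_nonneg
    (tsum_nonneg fun k => by positivity), Real.norm_of_nonneg (by positivity)]
  have hle : ∀ k : ((F : Set ℤ)ᶜ : Set ℤ), q ^ e k ≤ 2 ^ N * (1 / 2 : ℝ) ^ e k * q ^ N := by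
    intro k
    have hk : N ≤ e k := hF k k.2
    obtain ⟨j, hj⟩ := Nat.exists_eq_add_of_le hk
    have h2 : (2 : ℝ) ^ N * (1 / 2) ^ N = 1 := by rw [← mul_pow]; norm_num
    rw [hj, pow_add, pow_add, ← mul_assoc, h2, one_mul, mul_comm]
    gcongr
  calc ∑' k : ((F : Set ℤ)ᶜ : Set ℤ), q ^ e k
      ≤ ∑' k : ((F : Set ℤ)ᶜ : Set ℤ), 2 ^ N * (1 / 2 : ℝ) ^ e k * q ^ N :=
        (hsq.subtype _).tsum_le_tsum hle (((hsum.mul_left _).mul_right _).subtype _)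
    _ ≤ ∑' k : ℤ, 2 ^ N * (1 / 2 : ℝ) ^ e k * q ^ N :=
        Summable.tsum_subtype_le _ _ (fun k => by positivity) ((hsum.mul_left _).mul_right _)
    _ = _ := by rw [tsum_mul_right, tsum_mul_left]

/-- `θ₃` at `τ = i t`, as a function of `q = e ^ (-π t)`. -/
noncomputable def thetaT (q : ℝ) : ℝ := ∑' k : ℤ, q ^ (k ^ 2).toNat

/-- `θ₂ / (2 q ^ (1/4))` at `τ = i t`, as a function of `q = e ^ (-π t)`. -/
noncomputable def thetaS (q : ℝ) : ℝ := (∑' k : ℤ, q ^ (k ^ 2 + k).toNat) / 2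

theorem hasExpansion_thetaT : HasExpansion 4 thetaT (cubicSeries 1 2 0 0) := by
  refine (hasExpansion_iff (1 + 2 * Polynomial.X) fun i hi => ?_).2 ?_
  · interval_cases i <;> simp [Polynomial.coeff_one, Polynomial.coeff_X]
  · have := isBigO_tsum_pow_sub_sum (e := fun k => (k ^ 2).toNat) (fun k => ?_) 4 {-1, 0, 1}
      fun k hk => ?_
    · refine this.congr_left fun q => ?_
      norm_num [thetaT]
      ring
    · zify; rw [Int.toNat_of_nonneg (by positivity), ← sq_abs]; nlinarith [abs_nonneg k]
    · simp only [Finset.mem_insert, Finset.mem_singleton, not_or] at hk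
      have : 2 ≤ k ∨ k ≤ -2 := by omega
      zify; rw [Int.toNat_of_nonneg (by positivity)]
      rcases this with h | h <;> nlinarith

theorem sq_add_self_nonneg (k : ℤ) : 0 ≤ k ^ 2 + k := by
  rcases le_or_gt 0 k with h | h <;> nlinarith

theorem hasExpansion_thetaS : HasExpansion 4 thetaS (cubicSeries 1 0 1 0) := by
  refine (hasExpansion_iff (1 + Polynomial.X ^ 2) fun i hi => ?_).2 ?_
  · interval_cases i <;> simp [Polynomial.coeff_one, Polynomial.coeff_X_pow]
  · have := isBigO_tsum_pow_sub_sum (e := fun k => (k ^ 2 + k).toNat) (fun k => ?_) 4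
      {-2, -1, 0, 1} fun k hk => ?_
    · refine (this.const_mul_left (1 / 2)).congr_left fun q => ?_
      have h2 : Int.toNat 2 = 2 := rfl
      norm_num [thetaS, h2]
      ring
    · zify; rw [Int.toNat_of_nonneg (sq_add_self_nonneg k)]
      rcases abs_cases k with ⟨h, _⟩ | ⟨h, _⟩ <;> rw [h] <;> nlinarith [sq_nonneg (k + 1)]
    · simp only [Finset.mem_insert, Finset.mem_singleton, not_or] at hk
      have : 2 ≤ k ∨ k ≤ -3 := by omega
      zify; rw [Int.toNat_of_nonneg (sq_add_self_nonneg k)]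
      rcases this with h | h <;> nlinarith

theorem jacobiTheta_I_mul {t q : ℝ} (hq : q = Real.exp (-(Real.pi * t))) :
    jacobiTheta (Complex.I * t) = (thetaT q : ℂ) := by
  rw [jacobiTheta, thetaT, Complex.ofReal_tsum]
  refine tsum_congr fun k => ?_
  have hk : (((k ^ 2).toNat : ℕ) : ℂ) = (k : ℂ) ^ 2 := by
    have : (((k ^ 2).toNat : ℕ) : ℤ) = k ^ 2 := Int.toNat_of_nonneg (by positivity)
    exact_mod_cast this
  rw [hq, ← Real.exp_nat_mul, Complex.ofReal_exp]
  push_cast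
  rw [hk]
  congr 1
  linear_combination (Real.pi * (k : ℂ) ^ 2 * t) * Complex.I_sq

theorem theta2_I_mul {t q : ℝ} (hq : q = Real.exp (-(Real.pi * t))) :
    theta2 (Complex.I * t) = ((2 * Real.exp (-(Real.pi * t) / 4) * thetaS q : ℝ) : ℂ) := by
  rw [show 2 * Real.exp (-(Real.pi * t) / 4) * thetaS q =
    Real.exp (-(Real.pi * t) / 4) * ∑' k : ℤ, q ^ (k ^ 2 + k).toNat by rw [thetaS]; ring,
    ← tsum_mul_left, theta2, Complex.ofReal_tsum]
  refine tsum_congr fun k => ?_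
  have hk : (((k ^ 2 + k).toNat : ℕ) : ℂ) = (k : ℂ) ^ 2 + k := by
    have : (((k ^ 2 + k).toNat : ℕ) : ℤ) = k ^ 2 + k := Int.toNat_of_nonneg (sq_add_self_nonneg k)
    exact_mod_cast this
  rw [hq, ← Real.exp_nat_mul, ← Real.exp_add, Complex.ofReal_exp]
  push_cast
  rw [hk]
  congr 1
  linear_combination (Real.pi * ((k : ℂ) + 1 / 2) ^ 2 * t) * Complex.I_sq

/-- `λ(i t) / (16 q)` as a function of `q = e ^ (-π t)`. -/
noncomputable def lambdaQuot (q : ℝ) : ℝ := (thetaS q * (thetaT q)⁻¹) ^ 4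

theorem modularLambda_I_mul {t q : ℝ} (hq : q = Real.exp (-(Real.pi * t))) :
    modularLambda (Complex.I * t) = ((16 * q * lambdaQuot q : ℝ) : ℂ) := by
  rw [modularLambda, jacobiTheta_I_mul hq, theta2_I_mul hq, lambdaQuot, ← Complex.ofReal_pow,
    ← Complex.ofReal_pow, ← Complex.ofReal_div]
  congr 1
  have : Real.exp (-(Real.pi * t) / 4) ^ 4 = q := by
    rw [← Real.exp_nat_mul, hq]; congr 1; push_cast; ring
  rw [mul_pow, mul_pow, this]
  ring

theorem hasExpansion_theta_quotient :
    HasExpansion 4 (fun q => thetaS q * (thetaT q)⁻¹) (cubicSeries 1 (-2) 5 (-10)) := by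
  refine (hasExpansion_thetaS.mul (hasExpansion_thetaT.inv (ψ := cubicSeries 1 (-2) 4 (-8))
    (by norm_num) fun i hi => ?_)).congr_coeff fun i hi => ?_
  all_goals
    interval_cases i <;>
      norm_num [coeff_one_mul', coeff_two_mul, coeff_three_mul, coeff_one]

theorem hasExpansion_lambdaQuot : HasExpansion 4 lambdaQuot (cubicSeries 1 (-8) 44 (-192)) := by
  refine (hasExpansion_theta_quotient.pow 4).congr_coeff fun i hi => ?_
  interval_cases i
  · simp
  · norm_num [coeff_one_pow_of_eq_one]
  · norm_num [coeff_two_pow_of_eq_one]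
  · norm_num [coeff_three_pow_of_eq_one]

/-! ### Expansions of `X` and `Y` -/

theorem hasExpansion_lambdaQuot_comp_pow {p : ℕ} (hp : 3 ≤ p) :
    HasExpansion 3 (fun q => lambdaQuot (q ^ p)) 1 := by
  have := ((hasExpansion_lambdaQuot.mono (M := 1) (by norm_num)).comp_pow
    (p := p) (by omega)).mono hp
  simpa using this

/-- The factor `1 - λ(pτ)` is `1` up to `O(q ^ 4)`, except for the term `-16 q ^ 3` when `p = 3`. -/
theorem hasExpansion_one_sub_lambda_comp_pow {p : ℕ} (hp : 3 ≤ p) :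
    HasExpansion 4 (fun q => 1 - 16 * q ^ p * lambdaQuot (q ^ p))
      (cubicSeries 1 0 0 (-16 * if p = 3 then 1 else 0)) := by
  have h := (((hasExpansion_lambdaQuot_comp_pow hp).pow_mul p).const_mul 16).mono
    (show 4 ≤ p + 3 by omega)
  refine (((HasExpansion.const 4 1).sub h).congr_fun (.of_forall fun q => by ring)).congr_coeff
    fun i hi => ?_
  have h0 : p ≠ 0 := by omega
  have h1 : ¬ p = 1 := by omega
  have h2 : ¬ p = 2 := by omega
  interval_cases i
  · simp [h0]
  · simp [coeff_X_pow, eq_comm, h1]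
  · simp [coeff_X_pow, eq_comm, h2]
  · simp only [mul_one, map_sub, coeff_C_mul, coeff_X_pow, coeff_C, coeff_three_cubicSeries,
      eq_comm (a := 3)]
    split_ifs <;> simp_all

theorem hasExpansion_one_sub_lambda :
    HasExpansion 4 (fun q => 1 - 16 * q * lambdaQuot q) (cubicSeries 1 (-16) 128 (-704)) := by
  have h := (((hasExpansion_lambdaQuot.mono (M := 3) (by norm_num)).pow_mul 1).const_mul 16)
  refine (((HasExpansion.const 4 1).sub h).congr_fun (.of_forall fun q => by ring)).congr_coeff
    fun i hi => ?_
  interval_cases i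
  · simp
  · norm_num [coeff_one_mul', coeff_C]
  · norm_num [coeff_two_mul, coeff_C, coeff_X]
  · norm_num [coeff_three_mul, coeff_C, coeff_X]

/-- `X = 2 ^ n q ^ m u` with `u` as here; note `n α_p(2) = -3 n / 2`. -/
theorem exists_hasExpansion_X {p m n : ℕ} (hp : 3 ≤ p) (hmn : n * (p + 1) = 8 * m) {x : ℝ → ℝ}
    (hpos : ∀ᶠ q in 𝓝[>] 0, 0 ≤ x q)
    (hx : ∀ᶠ q in 𝓝[>] 0,
      x q ^ 8 = ((16 * q * lambdaQuot q) * (16 * q ^ p * lambdaQuot (q ^ p))) ^ n) :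
    ∃ u : ℝ → ℝ, (∀ᶠ q in 𝓝[>] 0, x q = 2 ^ n * q ^ m * u q) ∧
      HasExpansion 3 u (cubicSeries 1 (-n) ((3 * n + n ^ 2) / 2) 0) := by
  refine ⟨fun q => x q / (2 ^ n * q ^ m), ?_, ?_⟩
  · filter_upwards [self_mem_nhdsWithin] with q hq
    have hq : (0 : ℝ) < q := hq
    field_simp
  have h := ((hasExpansion_lambdaQuot.mono (M := 3) (by norm_num)).mul
    (hasExpansion_lambdaQuot_comp_pow hp)).pow n
  refine HasExpansion.of_pow (k := 8) (by norm_num) (by norm_num) (h.congr_fun ?_) ?_ (by simp)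
    fun i hi => ?_
  · filter_upwards [self_mem_nhdsWithin, hx] with q hq hxq
    have hq : (0 : ℝ) < q := hq
    have h2 : (256 : ℝ) ^ n * (q ^ (p + 1)) ^ n = (2 ^ n * q ^ m) ^ 8 := by
      rw [← pow_mul, mul_comm (p + 1) n, hmn, mul_pow, ← pow_mul, ← pow_mul, mul_comm n 8,
        pow_mul 2, mul_comm m 8]
      norm_num
    rw [div_pow, hxq, eq_div_iff (by positivity), ← h2, ← mul_pow, ← mul_pow]
    congr 1
    ring
  · filter_upwards [self_mem_nhdsWithin, hpos] with q hq hxq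
    have hq : (0 : ℝ) < q := hq
    positivity
  · interval_cases i
    · simp
    · rw [coeff_one_pow_of_eq_one (by simp), coeff_one_pow_of_eq_one (by simp)]
      norm_num
      ring
    · rw [coeff_two_pow_of_eq_one (by simp), coeff_two_pow_of_eq_one (by simp)]
      norm_num
      ring

/-- The expansion of `Y`, in which `a` stands for `α_p(3)`. -/
theorem hasExpansion_Y {p n : ℕ} {a : ℝ} (hp : 3 ≤ p) (ha : a = 4 / 3 + if p = 3 then 1 else 0)
    {y : ℝ → ℝ} (hpos : ∀ᶠ q in 𝓝[>] 0, 0 ≤ y q)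
    (hy : ∀ᶠ q in 𝓝[>] 0,
      y q ^ 8 = ((1 - 16 * q * lambdaQuot q) * (1 - 16 * q ^ p * lambdaQuot (q ^ p))) ^ n) :
    HasExpansion 4 y (cubicSeries 1 (-2 * n) (2 * n ^ 2) (-(2 * n * a + 4 * n ^ 3 / 3))) := by
  have h := (hasExpansion_one_sub_lambda.mul (hasExpansion_one_sub_lambda_comp_pow hp)).pow n
  refine HasExpansion.of_pow (k := 8) (by norm_num) (by norm_num)
    (h.congr_fun (hy.mono fun q hq => hq.symm)) hpos (by simp) fun i hi => ?_
  interval_cases i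
  · simp
  · rw [coeff_one_pow_of_eq_one (by simp), coeff_one_pow_of_eq_one (by simp), coeff_one_mul']
    norm_num
    ring
  · rw [coeff_two_pow_of_eq_one (by simp), coeff_two_pow_of_eq_one (by simp), coeff_one_mul',
      coeff_two_mul]
    norm_num
    ring
  · rw [coeff_three_pow_of_eq_one (by simp), coeff_three_pow_of_eq_one (by simp), coeff_one_mul',
      coeff_two_mul, coeff_three_mul, ha]
    simp only [coeff_zero_cubicSeries, coeff_one_cubicSeries, coeff_two_cubicSeries,
      coeff_three_cubicSeries]
    ring

/-- The real function `q ↦ g(i t)`, `q = e ^ (-π t)`, attached to an eighth power of a function that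
is real on the imaginary axis. -/
theorem IsEighthPower.exists_real {f g : ℂ → ℂ} {n : ℕ} (hg : IsEighthPower f n g) {F : ℝ → ℝ}
    (hF : ∀ t : ℝ, f (Complex.I * t) = F (Real.exp (-(Real.pi * t)))) :
    ∃ x : ℝ → ℝ, (∀ᶠ q in 𝓝[>] 0, 0 ≤ x q) ∧ (∀ᶠ q in 𝓝[>] 0, x q ^ 8 = F q ^ n) ∧
      ∀ᶠ q in 𝓝[>] 0, g (Complex.I * ((-Real.log q / Real.pi : ℝ) : ℂ)) = x q := by
  have key : ∀ᶠ q : ℝ in 𝓝[>] 0, 0 < -Real.log q / Real.pi ∧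
      Real.exp (-(Real.pi * (-Real.log q / Real.pi))) = q := by
    filter_upwards [Ioo_mem_nhdsGT (show (0 : ℝ) < 1 by norm_num)] with q hq
    refine ⟨div_pos (neg_pos.2 (Real.log_neg hq.1 hq.2)) Real.pi_pos, ?_⟩
    rw [mul_div_cancel₀ _ Real.pi_ne_zero, neg_neg, Real.exp_log hq.1]
  refine ⟨fun q => (g (Complex.I * ((-Real.log q / Real.pi : ℝ) : ℂ))).re, ?_, ?_, ?_⟩
  · filter_upwards [key] with q hq
    obtain ⟨r, hr, hgr⟩ := hg.pos _ hq.1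
    rw [hgr]
    exact hr.le
  · filter_upwards [key] with q hq
    obtain ⟨r, hr, hgr⟩ := hg.pos _ hq.1
    have h8 := hg.pow_eq (Complex.I * ((-Real.log q / Real.pi : ℝ) : ℂ))
      (by simpa [UpperHalfPlane.upperHalfPlaneSet] using hq.1)
    rw [hF, hq.2] at h8
    rw [hgr] at h8 ⊢
    exact_mod_cast h8
  · filter_upwards [key] with q hq
    obtain ⟨r, hr, hgr⟩ := hg.pos _ hq.1
    rw [hgr]
    rfl

theorem modularLambda_mul_I_mul (p : ℕ) (t : ℝ) :
    modularLambda (p * (Complex.I * t)) = ((16 * Real.exp (-(Real.pi * t)) ^ p *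
      lambdaQuot (Real.exp (-(Real.pi * t)) ^ p) : ℝ) : ℂ) := by
  rw [← modularLambda_I_mul (t := p * t) (q := Real.exp (-(Real.pi * t)) ^ p)]
  · congr 1
    push_cast
    ring
  · rw [← Real.exp_nat_mul]
    congr 1
    ring

/-! ### The first two rows of the coefficient matrix -/

/-- A polynomial of degree at most `m` in `y = 1 + b q + O(q ^ 2)`, `b ≠ 0`, that vanishes to the
order `q ^ m` is a multiple of `(y - 1) ^ m`. -/
theorem eq_one_sub_X_pow_of_isBigO {m : ℕ} {P : Polynomial ℝ} (hdeg : P.natDegree ≤ m)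
    (h0 : P.eval 0 = 1) {y : ℝ → ℝ} {φ : ℝ⟦X⟧} (hy : HasExpansion 2 y φ) (hφ0 : coeff 0 φ = 1)
    (hφ1 : coeff 1 φ ≠ 0) (hP : (fun q => P.eval (y q)) =O[𝓝[>] 0] (fun q => q ^ m)) :
    P = (1 - Polynomial.X) ^ m := by
  have hP0 : P ≠ 0 := by rintro rfl; simp at h0
  obtain ⟨R, hR, hdvd⟩ := Polynomial.exists_eq_pow_rootMultiplicity_mul_and_not_dvd P hP0 1
  set k := P.rootMultiplicity 1
  rw [Polynomial.dvd_iff_isRoot, Polynomial.IsRoot] at hdvd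
  have hy1 : Tendsto y (𝓝[>] 0) (𝓝 1) := hφ0 ▸ hy.tendsto (by norm_num)
  have hw : Tendsto (fun q => (y q - 1) / q) (𝓝[>] 0) (𝓝 (coeff 1 φ)) := by
    have : HasExpansion 1 (fun q => (y q - 1) / q) (C (coeff 1 φ)) := by
      refine HasExpansion.of_pow_mul 1 (((hy.sub (HasExpansion.const 2 1)).congr_fun ?_).congr_coeff
        fun i hi => ?_)
      · filter_upwards [self_mem_nhdsWithin] with q hq
        have hq : (0 : ℝ) < q := hq
        field_simp
      · rw [coeff_zero_eq_constantCoeff] at hφ0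
        interval_cases i <;> simp [hφ0]
    simpa using this.tendsto one_pos
  have hkm : m ≤ k := by
    by_contra! hlt
    have hlim : Tendsto (fun q => ((y q - 1) / q) ^ k * R.eval (y q)) (𝓝[>] 0)
        (𝓝 (coeff 1 φ ^ k * R.eval 1)) :=
      (hw.pow k).mul ((R.continuous.tendsto 1).comp hy1)
    have hO : (fun q => ((y q - 1) / q) ^ k * R.eval (y q)) =O[𝓝[>] 0]
        (fun q => q ^ (m - k)) := by
      refine ((isBigO_refl (fun q : ℝ => (q ^ k)⁻¹) (𝓝[>] 0)).mul hP).congr' ?_ ?_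
      · refine .of_forall fun q => ?_
        dsimp only
        nth_rewrite 1 [hR]
        simp only [Polynomial.eval_mul, Polynomial.eval_pow, Polynomial.eval_sub, Polynomial.eval_X,
          Polynomial.eval_C, div_pow]
        ring
      · filter_upwards [self_mem_nhdsWithin] with q hq
        have hq : (0 : ℝ) < q := hq
        rw [← Nat.add_sub_of_le hlt.le, pow_add, Nat.add_sub_cancel_left]
        field_simp
    have hz : Tendsto (fun q : ℝ => q ^ (m - k)) (𝓝[>] 0) (𝓝 0) := by
      have : Tendsto (fun q : ℝ => q ^ (m - k)) (𝓝 0) (𝓝 (0 ^ (m - k))) :=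
        (continuous_pow _).tendsto 0
      rw [zero_pow (by omega)] at this
      exact this.mono_left nhdsWithin_le_nhds
    have := tendsto_nhds_unique hlim (hO.trans_tendsto hz)
    exact mul_ne_zero (pow_ne_zero k hφ1) hdvd this
  have hR0 : R ≠ 0 := by rintro rfl; simp at hdvd
  have hdegs : P.natDegree = k + R.natDegree := by
    conv_lhs => rw [hR]
    rw [Polynomial.natDegree_mul (pow_ne_zero _ (Polynomial.X_sub_C_ne_zero 1)) hR0,
      Polynomial.natDegree_pow, Polynomial.natDegree_X_sub_C, mul_one]
  obtain ⟨c, rfl⟩ := Polynomial.natDegree_eq_zero.1 (show R.natDegree = 0 by omega)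
  have hk : k = m := by omega
  have hc : (-1) ^ m * c = 1 := by
    rw [hR, hk] at h0
    simpa using h0
  have hc' : c = (-1) ^ m := by
    have : (-1 : ℝ) ^ m * (-1) ^ m = 1 := by rw [← mul_pow]; simp
    linear_combination (-1 : ℝ) ^ m * hc - c * this
  rw [hR, hk, hc', map_pow, ← mul_pow]
  congr 1
  simp

theorem coeff_zero_sum_C_mul_pow {m : ℕ} (a : Fin m → ℝ) {φ : ℝ⟦X⟧} (h : coeff 0 φ = 1) :
    coeff 0 (∑ i, C (a i) * φ ^ (i : ℕ)) = ∑ i, a i := by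
  rw [map_sum]
  exact Finset.sum_congr rfl fun i _ => by rw [coeff_C_mul, coeff_zero_pow_of_eq_one h, mul_one]

theorem coeff_one_sum_C_mul_pow {m : ℕ} (a : Fin m → ℝ) {φ : ℝ⟦X⟧} (h : coeff 0 φ = 1) :
    coeff 1 (∑ i, C (a i) * φ ^ (i : ℕ)) = coeff 1 φ * ∑ i : Fin m, (i : ℕ) * a i := by
  rw [map_sum, Finset.mul_sum]
  refine Finset.sum_congr rfl fun i _ => ?_
  rw [coeff_C_mul, coeff_one_pow_of_eq_one h]
  ring

theorem coeff_two_sum_C_mul_pow {m : ℕ} (a : Fin m → ℝ) {φ : ℝ⟦X⟧} (h : coeff 0 φ = 1)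
    (h2 : coeff 2 φ = coeff 1 φ ^ 2 / 2) :
    coeff 2 (∑ i, C (a i) * φ ^ (i : ℕ)) = coeff 2 φ * ∑ i : Fin m, (i : ℕ) ^ 2 * a i := by
  rw [map_sum, Finset.mul_sum]
  refine Finset.sum_congr rfl fun i _ => ?_
  rw [coeff_C_mul, coeff_two_pow_of_eq_one h, h2]
  ring

/-- Comparison of the coefficients of `q ^ m`, `q ^ (m + 1)`, `q ^ (m + 2)` in
`∑ a_{i,h} X ^ i Y ^ h = 0`. The rows `i ≥ 2` contribute from `q ^ (2 m)` on, hence do not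
matter if `m ≥ 3`; if `m = 1` there are none. -/
theorem row_one_moments {m n : ℕ} {a : ℝ} (hm : m = 1 ∨ 3 ≤ m) (hn : 0 < n)
    (A : Fin (m + 1) → Fin (m + 1) → ℝ) (hA : A 0 0 = 1) {x y u : ℝ → ℝ}
    (hxu : ∀ᶠ q in 𝓝[>] 0, x q = 2 ^ n * q ^ m * u q)
    (hu : HasExpansion 3 u (cubicSeries 1 (-n) ((3 * n + n ^ 2) / 2) 0))
    (hy : HasExpansion 4 y (cubicSeries 1 (-2 * n) (2 * n ^ 2) (-(2 * n * a + 4 * n ^ 3 / 3))))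
    (hrel : ∀ᶠ q in 𝓝[>] 0, ∑ i, ∑ h, A i h * x q ^ (i : ℕ) * y q ^ (h : ℕ) = 0) :
    (2 * n) ^ m + 2 ^ n * ∑ h, A 1 h = 0 ∧
    (2 * n) ^ m * m + 2 ^ n * (∑ h, A 1 h + 2 * ∑ h : Fin (m + 1), (h : ℕ) * A 1 h) = 0 ∧
    (2 * n) ^ m * (m * (a + 2 * n ^ 2 / 3) + m * (m - 1) / 2 * n ^ 2) +
      2 ^ n * ((3 * n + n ^ 2) / 2 * ∑ h, A 1 h + 2 * n ^ 2 * ∑ h : Fin (m + 1), (h : ℕ) * A 1 h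
        + 2 * n ^ 2 * ∑ h : Fin (m + 1), (h : ℕ) ^ 2 * A 1 h) = 0 := by
  have hn' : (n : ℝ) ≠ 0 := by positivity
  set φ := cubicSeries (1 : ℝ) (-2 * n) (2 * n ^ 2) (-(2 * n * a + 4 * n ^ 3 / 3)) with hφ
  have hφ0 : coeff 0 φ = 1 := by simp [hφ]
  -- the rows, as functions of `q`
  let f : Fin (m + 1) → ℝ → ℝ := fun i q => ∑ h, A i h * y q ^ (h : ℕ)
  have hf : ∀ i, HasExpansion 4 (f i) (∑ h, C (A i h) * φ ^ (h : ℕ)) := fun i =>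
    HasExpansion.sum fun h _ => (hy.pow h).const_mul (A i h)
  have hrel' : ∀ᶠ q in 𝓝[>] 0, ∑ i : Fin (m + 1), x q ^ (i : ℕ) * f i q = 0 := by
    filter_upwards [hrel] with q hq
    rw [← hq]
    refine Finset.sum_congr rfl fun i _ => ?_
    rw [Finset.mul_sum]
    exact Finset.sum_congr rfl fun h _ => by ring
  -- the row `i = 0`
  have hxO : x =O[𝓝[>] 0] (fun q => q ^ m) := by
    have := ((isBigO_refl (fun q : ℝ => q ^ m) (𝓝[>] 0)).const_mul_left (2 ^ n)).mul hu.isBigO_one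
    simp only [mul_one] at this
    exact this.congr' (hxu.mono fun q hq => hq.symm) (EventuallyEq.refl _ _)
  have hf0 : ∀ q, f 0 q = (1 - y q) ^ m := by
    let P : Polynomial ℝ := ∑ h : Fin (m + 1), Polynomial.C (A 0 h) * Polynomial.X ^ (h : ℕ)
    have hPf : ∀ q, P.eval (y q) = f 0 q := fun q => by simp [P, f, Polynomial.eval_finsetSum]
    have hP : P = (1 - Polynomial.X) ^ m := by
      refine eq_one_sub_X_pow_of_isBigO ?_ ?_ (hy.mono (M := 2) (by norm_num)) hφ0
        (by simp [hφ, hn']) ?_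
      · refine Polynomial.natDegree_sum_le_of_forall_le _ _ fun h _ => ?_
        exact (Polynomial.natDegree_C_mul_X_pow_le _ _).trans (Nat.lt_succ_iff.1 h.2)
      · simp [P, Polynomial.eval_finsetSum, Fin.sum_univ_succ, hA]
      · have hO : (fun q => ∑ i : Fin m, x q * (x q ^ (i : ℕ) * f i.succ q)) =O[𝓝[>] 0]
            (fun q => q ^ m) := by
          refine IsBigO.fun_sum fun i _ => ?_
          have hx1 : x =O[𝓝[>] 0] (fun _ => (1 : ℝ)) := by
            simpa using hxO.trans (isBigO_pow_of_le (Nat.zero_le m))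
          simpa using hxO.mul ((hx1.pow (i : ℕ)).mul (hf i.succ).isBigO_one)
        refine hO.neg_left.congr' ?_ (EventuallyEq.refl _ _)
        filter_upwards [hrel'] with q hq
        rw [Fin.sum_univ_succ] at hq
        rw [hPf, eq_comm, eq_neg_iff_add_eq_zero, ← hq]
        simp [pow_succ', mul_assoc]
    intro q
    rw [← hPf, hP]
    simp
  -- `1 - Y = 2 n q w`
  let w : ℝ → ℝ := fun q => (1 - y q) / (2 * n * q)
  have hw : HasExpansion 3 w (cubicSeries 1 (-n) (a + 2 * n ^ 2 / 3) 0) := by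
    refine HasExpansion.of_pow_mul 1 (((((HasExpansion.const 4 1).sub hy).const_mul
      (1 / (2 * n))).congr_fun ?_).congr_coeff fun i hi => ?_)
    · filter_upwards [self_mem_nhdsWithin] with q hq
      have hq : (0 : ℝ) < q := hq
      simp only [w]
      field_simp
    · interval_cases i
      · simp [hφ]
      · simp [hφ, coeff_one_mul', coeff_C]
        field_simp
      · simp [hφ, coeff_two_mul, coeff_C]
        field_simp
      · simp [hφ, coeff_three_mul, coeff_C]
        field_simp
        ring
  -- division of the relation by `q ^ m`
  obtain ⟨m', rfl⟩ : ∃ m', m = m' + 1 := ⟨m - 1, by omega⟩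
  let g : ℝ → ℝ := fun q => ∑ j : Fin m', (2 ^ n * u q) ^ 2 *
    ((2 ^ n * (q ^ (m' + 1) * u q)) ^ (j : ℕ) * f j.succ.succ q)
  have hdiv : ∀ᶠ q in 𝓝[>] 0,
      (2 * n) ^ (m' + 1) * w q ^ (m' + 1) + 2 ^ n * (u q * f 1 q) + q ^ (m' + 1) * g q = 0 := by
    filter_upwards [self_mem_nhdsWithin, hrel', hxu] with q hq hr hx
    have hq : (0 : ℝ) < q := hq
    have hyw : 1 - y q = 2 * n * q * w q := by simp only [w]; field_simp
    rw [Fin.sum_univ_succ, Fin.sum_univ_succ, hf0, hyw, hx] at hr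
    refine (mul_eq_zero.1 (?_ : q ^ (m' + 1) * _ = 0)).resolve_left (by positivity)
    rw [← hr]
    simp only [g, Fin.val_zero, Fin.val_succ, Fin.succ_zero_eq_one, Fin.val_one, pow_one, pow_zero,
       Finset.mul_sum, mul_add]
    rw [add_assoc]
    congr 1
    · ring_nf
    · congr 1
      · ring
      · exact Finset.sum_congr rfl fun j _ => by ring
  have hrest : HasExpansion 3 (fun q => q ^ (m' + 1) * g q) 0 := by
    rcases Nat.eq_zero_or_pos m' with rfl | hpos
    · simpa [g] using HasExpansion.const 3 0
    · have hO : (fun q => q ^ (m' + 1) * g q) =O[𝓝[>] 0] (fun q => q ^ (m' + 1)) := by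
        have hg : g =O[𝓝[>] 0] (fun _ => (1 : ℝ)) := by
          refine IsBigO.fun_sum fun j _ => ?_
          have hu1 := hu.isBigO_one
          have hq1 : (fun q : ℝ => q ^ (m' + 1)) =O[𝓝[>] 0] (fun _ => (1 : ℝ)) := by
            simpa using isBigO_pow_of_le (Nat.zero_le (m' + 1))
          simpa using ((hu1.const_mul_left (2 ^ n)).pow 2).mul
            ((((hq1.mul hu1).const_mul_left (2 ^ n)).pow (j : ℕ)).mul (hf j.succ.succ).isBigO_one)
        simpa using (isBigO_refl (fun q : ℝ => q ^ (m' + 1)) (𝓝[>] 0)).mul hg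
      rw [hasExpansion_iff 0 (by simp)]
      simpa using hO.trans (isBigO_pow_of_le (show 3 ≤ m' + 1 by omega))
  have hmain := ((((hw.pow (m' + 1)).const_mul ((2 * n) ^ (m' + 1))).add
    ((hu.mul ((hf 1).mono (M := 3) (by norm_num))).const_mul (2 ^ n))).add hrest).congr_fun hdiv
  have hcoef : ∀ i < 3, _ = (0 : ℝ) := fun i hi =>
    (hmain.coeff_eq (HasExpansion.const 3 0) hi).trans (by simp)
  have e0 := hcoef 0 (by norm_num)
  have e1 := hcoef 1 (by norm_num)
  have e2 := hcoef 2 (by norm_num)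
  have hs0 := coeff_zero_sum_C_mul_pow (A 1) hφ0
  have hs1 := coeff_one_sum_C_mul_pow (A 1) hφ0
  have hs2 := coeff_two_sum_C_mul_pow (A 1) hφ0 (by simp [hφ]; ring)
  rw [map_add, map_add, map_zero, add_zero, coeff_C_mul, coeff_C_mul] at e0 e1 e2
  rw [coeff_zero_pow_of_eq_one (by simp), coeff_zero_mul, hs0] at e0
  rw [coeff_one_pow_of_eq_one (by simp), coeff_one_mul', hs0, hs1] at e1
  rw [coeff_two_pow_of_eq_one (by simp), coeff_two_mul, hs0, hs1, hs2] at e2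
  simp only [hφ, coeff_zero_cubicSeries, coeff_one_cubicSeries, coeff_two_cubicSeries] at e0 e1 e2
  refine ⟨by linear_combination e0, mul_left_cancel₀ hn' ?_, by linear_combination e2⟩
  linear_combination -e1

end RussellModular

theorem mainTheorem1 (p m n : ℕ) (hp : p.Prime) (hodd : Odd p)
    (hn : 0 < n) (hcop : Nat.Coprime m n) (hmn : ((p : ℚ) + 1) / 8 = (m : ℚ) / (n : ℚ))
    (A : Matrix (Fin (m + 1)) (Fin (m + 1)) ℤ) (hA : RussellModular.IsRussellMatrix p m n A) :
    (∑ h : Fin (m + 1), (A 1 h : ℚ)) = -((n : ℚ) ^ m * (2 : ℚ) ^ ((m : ℤ) - n)) ∧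
    (∑ h : Fin (m + 1), (1 + 2 * ((h : ℕ) : ℚ)) * (A 1 h : ℚ)) =
      -((n : ℚ) ^ m * (2 : ℚ) ^ ((m : ℤ) + 1 - n) * RussellModular.stirlingP 1 m) ∧
    (∑ h : Fin (m + 1), (1 + 2 * ((h : ℕ) : ℚ)) ^ 2 * (A 1 h : ℚ)) =
      -((n : ℚ) ^ m * (2 : ℚ) ^ ((m : ℤ) + 3 - n) * RussellModular.stirlingP 2 m)
        - (n : ℚ) ^ ((m : ℤ) - 1) * (2 : ℚ) ^ ((m : ℤ) + 1 - n) * RussellModular.alpha p 2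
        - (n : ℚ) ^ ((m : ℤ) - 2) * (2 : ℚ) ^ ((m : ℤ) + 1 - n) * (m : ℚ)
            * RussellModular.alpha p 3 := by
  open RussellModular in
  have hn' : (n : ℚ) ≠ 0 := by positivity
  have hp3 : 3 ≤ p := by
    have := hp.two_le
    obtain ⟨k, hk⟩ := hodd
    omega
  have hnat : n * (p + 1) = 8 * m := by
    rw [div_eq_div_iff (by norm_num) hn'] at hmn
    have : (n : ℚ) * (p + 1) = 8 * m := by linear_combination hmn
    exact_mod_cast this
  -- `m = 2` would force `p = 15`
  have hm : m = 1 ∨ 3 ≤ m := by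
    rcases m with _ | _ | _ | m
    · have : 0 < n * (p + 1) := by positivity
      omega
    · exact Or.inl rfl
    · exfalso
      have h1 : n ∣ 2 ^ 4 := ⟨p + 1, by omega⟩
      have h2 : n = 1 := Nat.Coprime.eq_one_of_dvd (Nat.Coprime.pow_right 4 hcop.symm) h1
      have h3 : p = 15 := by rw [h2] at hnat; omega
      rw [h3] at hp
      norm_num at hp
    · right; omega
  obtain ⟨X, Y, hX, hY, hXY⟩ := hA.vanishes
  obtain ⟨x, hx0, hx8, hxX⟩ := hX.exists_real
    (F := fun q => (16 * q * lambdaQuot q) * (16 * q ^ p * lambdaQuot (q ^ p)))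
    fun t => by
      simp only [modularLambda_I_mul (t := t) rfl, modularLambda_mul_I_mul p t]
      push_cast
      rfl
  obtain ⟨y, hy0, hy8, hyY⟩ := hY.exists_real
    (F := fun q => (1 - 16 * q * lambdaQuot q) * (1 - 16 * q ^ p * lambdaQuot (q ^ p)))
    fun t => by
      simp only [modularLambda_I_mul (t := t) rfl, modularLambda_mul_I_mul p t]
      push_cast
      rfl
  have hrel : ∀ᶠ q in nhdsWithin (0 : ℝ) (Set.Ioi 0), ∑ i : Fin (m + 1), ∑ h : Fin (m + 1),
      (A i h : ℝ) * x q ^ (i : ℕ) * y q ^ (h : ℕ) = 0 := by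
    filter_upwards [hxX, hyY, Ioo_mem_nhdsGT (show (0 : ℝ) < 1 by norm_num)] with q h1 h2 hq
    have := hXY (Complex.I * ((-Real.log q / Real.pi : ℝ) : ℂ)) (by
      simpa [UpperHalfPlane.upperHalfPlaneSet] using
        div_pos (neg_pos.2 (Real.log_neg hq.1 hq.2)) Real.pi_pos)
    rw [h1, h2] at this
    exact_mod_cast this
  obtain ⟨u, hxu, hu⟩ := exists_hasExpansion_X hp3 hnat hx0 hx8
  have hy := hasExpansion_Y (a := ((alpha p 3 : ℚ) : ℝ)) hp3
    (by rw [alpha_three hp3]; split_ifs <;> norm_num) hy0 hy8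
  obtain ⟨e0, e1, e2⟩ := row_one_moments hm hn (fun i h => (A i h : ℝ)) (by simp [hA.corner])
    hxu hu hy hrel
  have r0 : (2 * (n : ℚ)) ^ m + 2 ^ n * ∑ h, (A 1 h : ℚ) = 0 := by exact_mod_cast e0
  have r1 : (2 * (n : ℚ)) ^ m * m +
      2 ^ n * (∑ h, (A 1 h : ℚ) + 2 * ∑ h : Fin (m + 1), ((h : ℕ) : ℚ) * A 1 h) = 0 := by
    exact_mod_cast e1
  have r2 : (2 * (n : ℚ)) ^ m * (m * (alpha p 3 + 2 * n ^ 2 / 3) + m * (m - 1) / 2 * n ^ 2) +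
      2 ^ n * ((3 * n + n ^ 2) / 2 * ∑ h, (A 1 h : ℚ)
        + 2 * n ^ 2 * ∑ h : Fin (m + 1), ((h : ℕ) : ℚ) * A 1 h
        + 2 * n ^ 2 * ∑ h : Fin (m + 1), ((h : ℕ) : ℚ) ^ 2 * A 1 h) = 0 := by
    refine Rat.cast_injective (α := ℝ) ?_
    push_cast
    linear_combination e2
  have l1 : ∑ h : Fin (m + 1), (1 + 2 * ((h : ℕ) : ℚ)) * (A 1 h : ℚ) =
      ∑ h, (A 1 h : ℚ) + 2 * ∑ h : Fin (m + 1), ((h : ℕ) : ℚ) * A 1 h := by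
    rw [Finset.mul_sum, ← Finset.sum_add_distrib]
    exact Finset.sum_congr rfl fun h _ => by ring
  have l2 : ∑ h : Fin (m + 1), (1 + 2 * ((h : ℕ) : ℚ)) ^ 2 * (A 1 h : ℚ) =
      ∑ h, (A 1 h : ℚ) + 4 * ∑ h : Fin (m + 1), ((h : ℕ) : ℚ) * A 1 h
        + 4 * ∑ h : Fin (m + 1), ((h : ℕ) : ℚ) ^ 2 * A 1 h := by
    rw [Finset.mul_sum, Finset.mul_sum, ← Finset.sum_add_distrib, ← Finset.sum_add_distrib]
    exact Finset.sum_congr rfl fun h _ => by ring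
  have two : (2 : ℚ) ≠ 0 := two_ne_zero
  rw [l1, l2, stirlingP_one, stirlingP_two, alpha_two hp3]
  generalize ∑ h, (A 1 h : ℚ) = S0 at *
  generalize ∑ h : Fin (m + 1), ((h : ℕ) : ℚ) * A 1 h = S1 at *
  generalize ∑ h : Fin (m + 1), ((h : ℕ) : ℚ) ^ 2 * A 1 h = S2 at *
  rw [mul_pow] at r0 r1 r2
  simp only [zpow_sub₀ two, zpow_add₀ two, zpow_sub₀ hn', zpow_natCast, zpow_one]
  norm_num
  refine ⟨?_, ?_, ?_⟩
  · field_simp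
    linear_combination r0
  · field_simp
    linear_combination r1
  · field_simp
    linear_combination 48 * r2 - 72 * n * r0
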